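/- Let $n\ge 1$ and let $x_1,\dots,x_m\in\mathbb{R}^n$ span $\mathbb{R}^n$; let $X=[x_1,\dots,x_m]$. For $u\in\mathbb{R}^m$ with $u\ge 0$ and $X\,\mathrm{diag}(u)X^T$ positive definite, put $\kappa(u)_i=x_i^T(X\,\mathrm{diag}(u)X^T)^{-1}x_i$ and $h(u)=-\ln\det(X\,\mathrm{diag}(u)X^T)+n(e^Tu-1)$, so that $\nabla h(u)_i=n-\kappa(u)_i$. Such a $u$ is called $\epsilon$-approximately optimal if $\kappa(u)_i\le(1+\epsilon)n$ for all $i$ and $\kappa(u)_i\ge(1-\epsilon)n$ for all $i$ with $u_i>0$. The coordinate descent (CD) algorithm for minimizing $h$ over $u\ge 0$ starts from a $u_0$ that puts equal weights, of sum $1$, on a subset of the data points spanning $\mathbb{R}^n$ (all the points in Khachiyan's initialization scheme, at most $2n$ selected points in the Kumar–Yıldırım scheme). At the iterate $u$ it chooses, with ties broken arbitrarily, a coordinate $j$ maximizing $|n-\kappa(u)_i|$ over the coordinates $i$ with $u_i>0$ or $\kappa(u)_i>n$, and changes only the $j$th coordinate: - if $\kappa(u)_j\ge n$, then $u_j$ becomes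 $u_j+\dfrac{\kappa(u)_j-n}{\kappa(u)_j^2}$; - if $\kappa(u)_j<n$, then $u_j$ becomes $\max\left\{0,\;u_j-\dfrac{n-\kappa(u)_j}{n\,\kappa(u)_j}\right\}$ (which is read as $0$ if $\kappa(u)_j=0$). Theorem 3 (the CD algorithm is locally linearly convergent). There are constants $P$ and $Q$, depending only on the data $x_1,\dots,x_m$, such that for every $\epsilon\in(0,1]$ every run of the CD algorithm reaches an $\epsilon$-approximately optimal $u$ after at most $P+Q\log_2(1/\epsilon)$ iterations. -/

import Mathlib

open scoped Matrix

namespace MVEE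

noncomputable section

/-- The matrix `X U Xᵀ`, where the columns `x₁, …, xₘ` of `X` are the data points and `U` is the
diagonal matrix with diagonal `u`. -/
def gram {n m : ℕ} (X : Matrix (Fin n) (Fin m) ℝ) (u : Fin m → ℝ) : Matrix (Fin n) (Fin n) ℝ :=
  X * Matrix.diagonal u * Xᵀ

/-- `κ(u)ᵢ = xᵢᵀ H(u) xᵢ` with `H(u) = (X U Xᵀ)⁻¹`. -/
def kappa {n m : ℕ} (X : Matrix (Fin n) (Fin m) ℝ) (u : Fin m → ℝ) (i : Fin m) : ℝ :=
  X.col i ⬝ᵥ ((gram X u)⁻¹ *ᵥ X.col i)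

/-- `u ≥ 0` with `X U Xᵀ` positive definite, i.e. `u` is feasible for the problem of minimizing
`h(u) = - ln det (X U Xᵀ) + n (eᵀ u - 1)` over `u ≥ 0` (and lies in the domain of `h`). -/
def Feasible {n m : ℕ} (X : Matrix (Fin n) (Fin m) ℝ) (u : Fin m → ℝ) : Prop :=
  (∀ i, 0 ≤ u i) ∧ (gram X u).PosDef

/-- `ε`-primal feasibility: `xᵢᵀ H(u) xᵢ ≤ (1 + ε) n` for all `i`. -/
def PrimalFeasible {n m : ℕ} (X : Matrix (Fin n) (Fin m) ℝ) (ε : ℝ) (u : Fin m → ℝ) : Prop :=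
  Feasible X u ∧ ∀ i, kappa X u i ≤ (1 + ε) * n

/-- `ε`-approximate optimality: `ε`-primal feasible, and `xᵢᵀ H(u) xᵢ ≥ (1 - ε) n` if `uᵢ > 0`. -/
def ApproxOptimal {n m : ℕ} (X : Matrix (Fin n) (Fin m) ℝ) (ε : ℝ) (u : Fin m → ℝ) : Prop :=
  PrimalFeasible X ε u ∧ ∀ i, 0 < u i → (1 - ε) * n ≤ kappa X u i

/-- The partial derivative `∇h(u)ᵢ = n - κ(u)ᵢ`. -/
def gradH {n m : ℕ} (X : Matrix (Fin n) (Fin m) ℝ) (u : Fin m → ℝ) (i : Fin m) : ℝ :=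
  n - kappa X u i

/-- The coordinates in play: `uᵢ > 0` (the range of `j₋`), or `κ(u)ᵢ > n`. For all others the
projected step is void, because `uᵢ = 0` and `∇h(u)ᵢ ≥ 0`. -/
def Movable {n m : ℕ} (X : Matrix (Fin n) (Fin m) ℝ) (u : Fin m → ℝ) (i : Fin m) : Prop :=
  0 < u i ∨ (n : ℝ) < kappa X u i

/-- Gauss - Southwell's rule, ties broken arbitrarily: `j` maximizes `|∇h(u)ᵢ|` over the coordinates
in play. So `j = j₊` (largest `κ(u)ᵢ`) if `κ₊ - n > n - κ₋`, and `j = j₋` (smallest `κ(u)ᵢ` among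
`uᵢ > 0`) if `κ₊ - n < n - κ₋`. -/
def IsGaussSouthwell {n m : ℕ} (X : Matrix (Fin n) (Fin m) ℝ) (u : Fin m → ℝ) (j : Fin m) : Prop :=
  Movable X u j ∧ ∀ i, Movable X u i → |gradH X u i| ≤ |gradH X u j|

open Classical in
/-- The new value `max (0, uⱼ - ∇h(u)ⱼ / Lⱼ)` of coordinate `j`, with `Lⱼ = κ(u)ⱼ²` if `κ(u)ⱼ ≥ n`
and `Lⱼ = n κ(u)ⱼ` if `κ(u)ⱼ < n`. The test `(n - κⱼ) / (n κⱼ) ≤ uⱼ` is written without division;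
so for `κⱼ = 0` (i.e. `xⱼ = 0`, infinite stepsize) the coordinate is dropped. -/
def newValue {n m : ℕ} (X : Matrix (Fin n) (Fin m) ℝ) (u : Fin m → ℝ) (j : Fin m) : ℝ :=
  if (n : ℝ) ≤ kappa X u j then u j + (kappa X u j - n) / (kappa X u j) ^ 2
  else if n - kappa X u j ≤ u j * (n * kappa X u j) then
    u j - (n - kappa X u j) / (n * kappa X u j)
  else 0

/-- One iteration of the coordinate descent algorithm: `u'` is a possible successor of `u`. -/
def CDStep {n m : ℕ} (X : Matrix (Fin n) (Fin m) ℝ) (u u' : Fin m → ℝ) : Prop :=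
  ∃ j, IsGaussSouthwell X u j ∧ u' = Function.update u j (newValue X u j)

/-- Initial points: equal weights on a subset `S` of the data points that spans `ℝⁿ`. Khachiyan's
scheme is `S` = all points; the Kumar - Yildirim scheme selects a spanning `S` of at most `2n`
points by successive maximization along directions. -/
def IsInitial {n m : ℕ} (X : Matrix (Fin n) (Fin m) ℝ) (u : Fin m → ℝ) : Prop :=
  ∃ S : Finset (Fin m), Submodule.span ℝ (X.col '' (S : Set (Fin m))) = ⊤ ∧
    ∀ i, u i = if i ∈ S then 1 / (S.card : ℝ) else 0

/-- A sequence of iterates of the coordinate descent algorithm. -/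
def IsCDRun {n m : ℕ} (X : Matrix (Fin n) (Fin m) ℝ) (u : ℕ → Fin m → ℝ) : Prop :=
  IsInitial X (u 0) ∧ ∀ k, CDStep X (u k) (u (k + 1))

end

end MVEE

/-! Write `g` for the largest `|∇h(u)ᵢ|` over the coordinates in play. A step that does not truncate
at zero lowers `h` by at least `g² / (4B²)`, where `B` bounds `κ` on the initial level set
(`full_step`). Conversely the optimality gap there is at most `C g²` (`exists_gap_le_sq`), so such a
step shrinks the gap by a fixed factor. A truncating step only guarantees descent, but it removes a
support point while any other step adds at most one; hence truncations outnumber the other steps by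
at most `m`. As `n ≥ 1`, failure of `ε`-optimality forces `g > ε`, hence a gap of at least a
multiple of `ε²` before each non-truncating step, and geometric decay bounds their number.

The error bound needs no uniqueness or strict complementarity. Minimizers may differ by directions
that change neither the Gram matrix nor the total weight. A Hoffman-type argument removes these from
the displacement towards a minimizer, and what remains has length `O(g)`. Convexity bounds the gap
by `g` times that length, up to a constant. -/

namespace MVEE

/-! ### Gram matrices, `κ` and rank-one updates -/

section LinearAlgebra

variable {n m : ℕ} (X : Matrix (Fin n) (Fin m) ℝ)

lemma gram_apply (u : Fin m → ℝ) (a b : Fin n) : gram X u a b = ∑ i, u i * (X a i * X b i) := by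
  rw [gram, Matrix.mul_apply]
  simp only [Matrix.mul_diagonal, Matrix.transpose_apply]
  exact Finset.sum_congr rfl fun i _ => by ring

lemma gram_add (u v : Fin m → ℝ) : gram X (u + v) = gram X u + gram X v := by
  ext a b
  simp [gram_apply, add_mul, Finset.sum_add_distrib]

lemma gram_sub (u v : Fin m → ℝ) : gram X (u - v) = gram X u - gram X v := by
  ext a b
  simp [gram_apply, sub_mul, Finset.sum_sub_distrib]

lemma gram_smul (c : ℝ) (u : Fin m → ℝ) : gram X (c • u) = c • gram X u := by
  ext a b
  simp [gram_apply, Finset.mul_sum, mul_assoc]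

lemma gram_isHermitian (u : Fin m → ℝ) : (gram X u).IsHermitian := by
  ext a b
  simp [gram_apply, mul_comm]

lemma continuous_gram : Continuous (gram X) := by
  refine continuous_pi fun a => continuous_pi fun b => ?_
  simp only [gram_apply]
  fun_prop

lemma gram_posSemidef {u : Fin m → ℝ} (hu : ∀ i, 0 ≤ u i) : (gram X u).PosSemidef := by
  have h := (Matrix.PosSemidef.diagonal (d := u) hu).mul_mul_conjTranspose_same X
  simpa [gram, Matrix.conjTranspose_eq_transpose_of_trivial] using h

lemma dotProduct_gram_mulVec (u : Fin m → ℝ) (v : Fin n → ℝ) :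
    v ⬝ᵥ (gram X u *ᵥ v) = ∑ i, u i * (v ⬝ᵥ X.col i) ^ 2 := by
  have : gram X u *ᵥ v = X *ᵥ (Matrix.diagonal u *ᵥ (Xᵀ *ᵥ v)) := by
    simp [gram, Matrix.mulVec_mulVec, Matrix.mul_assoc]
  rw [this, Matrix.dotProduct_mulVec, ← Matrix.mulVec_transpose, dotProduct]
  refine Finset.sum_congr rfl fun i _ => ?_
  rw [Matrix.mulVec_diagonal]
  have : (Xᵀ *ᵥ v) i = v ⬝ᵥ X.col i := by
    rw [dotProduct_comm]; rfl
  rw [this]; ring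

lemma feasible_iff (u : Fin m → ℝ) :
    Feasible X u ↔ (∀ i, 0 ≤ u i) ∧ 0 < (gram X u).det :=
  and_congr_right fun hu => ⟨fun h => h.det_pos, fun h =>
    (gram_posSemidef X hu).posDef_iff_det_ne_zero.2 h.ne'⟩

lemma feasible_of_isInitial (hn : 0 < n) {u : Fin m → ℝ} (hu : IsInitial X u) :
    Feasible X u ∧ ∑ i, u i = 1 := by
  obtain ⟨S, hS, hu⟩ := hu
  have hne : S.Nonempty := by
    rw [Finset.nonempty_iff_ne_empty]
    rintro rfl
    have : Nonempty (Fin n) := ⟨⟨0, hn⟩⟩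
    simp only [Finset.coe_empty, Set.image_empty, Submodule.span_empty] at hS
    exact bot_ne_top hS
  have hcard : (0 : ℝ) < S.card := by exact_mod_cast hne.card_pos
  have hnn : ∀ i, 0 ≤ u i := fun i => by
    rw [hu]; split_ifs <;> positivity
  refine ⟨⟨hnn, Matrix.PosDef.of_dotProduct_mulVec_pos (gram_isHermitian X u) fun v hv => ?_⟩, ?_⟩
  · rw [star_trivial, dotProduct_gram_mulVec]
    have h0 : ∀ i ∈ Finset.univ, 0 ≤ u i * (v ⬝ᵥ X.col i) ^ 2 := fun i _ =>
      mul_nonneg (hnn i) (sq_nonneg _)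
    refine (Finset.sum_nonneg h0).lt_of_ne' fun h => hv ?_
    rw [Finset.sum_eq_zero_iff_of_nonneg h0] at h
    have hle : Submodule.span ℝ (X.col '' (S : Set (Fin m))) ≤
        LinearMap.ker (dotProductBilin ℝ ℝ v) := by
      rw [Submodule.span_le]
      rintro _ ⟨i, hi, rfl⟩
      have := h i (Finset.mem_univ i)
      rw [hu, if_pos (Finset.mem_coe.1 hi)] at this
      simpa [hcard.ne'] using this
    rw [hS] at hle
    have : v ⬝ᵥ v = 0 := by simpa using hle (Submodule.mem_top (x := v))
    exact dotProduct_self_eq_zero.1 this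
  · simp only [hu]
    rw [Finset.sum_ite_mem, Finset.univ_inter, Finset.sum_const, nsmul_eq_mul]
    field_simp

lemma trace_mul_gram (A : Matrix (Fin n) (Fin n) ℝ) (v : Fin m → ℝ) :
    (A * gram X v).trace = ∑ i, v i * (X.col i ⬝ᵥ (A *ᵥ X.col i)) := by
  simp only [Matrix.trace, Matrix.diag, Matrix.mul_apply, gram_apply, Matrix.mulVec, dotProduct,
    Matrix.col_apply, Finset.mul_sum]
  rw [Finset.sum_congr rfl fun a _ => Finset.sum_comm, Finset.sum_comm]
  exact Finset.sum_congr rfl fun i _ => Finset.sum_congr rfl fun a _ =>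
    Finset.sum_congr rfl fun b _ => by ring

/-- This is the derivative of `ln det` at `u` in direction `v`; it turns gradient pairings into
traces. -/
lemma sum_mul_kappa (u v : Fin m → ℝ) :
    ∑ i, v i * kappa X u i = ((gram X u)⁻¹ * gram X v).trace :=
  (trace_mul_gram X _ v).symm

lemma sum_mul_kappa_self {u : Fin m → ℝ} (hu : Feasible X u) : ∑ i, u i * kappa X u i = n := by
  rw [sum_mul_kappa, Matrix.nonsing_inv_mul _ hu.2.det_pos.ne'.isUnit]
  simp

lemma kappa_nonneg {u : Fin m → ℝ} (hu : Feasible X u) (i : Fin m) : 0 ≤ kappa X u i := by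
  have h := hu.2.inv.posSemidef.dotProduct_mulVec_nonneg (X.col i)
  rwa [star_trivial] at h

lemma gram_update (u : Fin m → ℝ) (j : Fin m) (c : ℝ) :
    gram X (Function.update u j c) =
      gram X u + Matrix.replicateCol Unit ((c - u j) • X.col j) *
        Matrix.replicateRow Unit (X.col j) := by
  have : Function.update u j c = u + Pi.single j (c - u j) := by
    ext i
    by_cases h : i = j
    · subst h; simp
    · simp [h]
  rw [this, gram_add]
  congr 1
  ext a b
  rw [gram_apply, Finset.sum_eq_single j]
  · simp [Matrix.mul_apply, mul_assoc]
  · intro i _ hi; simp [hi]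
  · simp

lemma det_gram_update {u : Fin m → ℝ} (hu : (gram X u).det ≠ 0) (j : Fin m) (c : ℝ) :
    (gram X (Function.update u j c)).det = (gram X u).det * (1 + (c - u j) * kappa X u j) := by
  rw [gram_update, Matrix.det_add_replicateCol_mul_replicateRow hu.isUnit]
  congr 1
  simp only [Matrix.det_unique, Matrix.add_apply, Matrix.one_apply_eq, Matrix.mul_apply,
    Matrix.replicateRow_apply, Matrix.replicateCol_apply, kappa, dotProduct, Matrix.mulVec]
  simp only [Finset.sum_mul, Finset.mul_sum, Pi.smul_apply, smul_eq_mul]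
  rw [Finset.sum_comm]
  congr 1
  exact Finset.sum_congr rfl fun a _ => Finset.sum_congr rfl fun b _ => by ring

end LinearAlgebra

/-! ### Inequalities for positive definite matrices -/

section PosDef

variable {n : ℕ} {A B C : Matrix (Fin n) (Fin n) ℝ}

lemma log_det_le_trace_sub (hA : A.PosDef) : Real.log A.det ≤ A.trace - n := by
  have hd : A.det = ∏ i, hA.1.eigenvalues i := by simpa using hA.1.det_eq_prod_eigenvalues
  have ht : A.trace = ∑ i, hA.1.eigenvalues i := by simpa using hA.1.trace_eq_sum_eigenvalues
  rw [hd, ht, Real.log_prod fun i _ => (hA.eigenvalues_pos i).ne']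
  calc ∑ i, Real.log (hA.1.eigenvalues i) ≤ ∑ i, (hA.1.eigenvalues i - 1) :=
        Finset.sum_le_sum fun i _ => Real.log_le_sub_one_of_pos (hA.eigenvalues_pos i)
    _ = _ := by simp [Finset.sum_sub_distrib]

open scoped MatrixOrder Matrix.Norms.L2Operator in
lemma exists_eq_transpose_mul_self (hA : A.PosDef) :
    ∃ B : Matrix (Fin n) (Fin n) ℝ, IsUnit B ∧ A = Bᵀ * B := by
  obtain ⟨B, hB, h⟩ := CStarAlgebra.isStrictlyPositive_iff_eq_star_mul_self.mp
    hA.isStrictlyPositive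
  exact ⟨B, hB, by
    rw [h, Matrix.star_eq_conjTranspose, Matrix.conjTranspose_eq_transpose_of_trivial]⟩

/-- Tangent inequality for the concave function `ln det`: factor `A⁻¹ = RᵀR` and sum `ln λ ≤ λ - 1`
over the eigenvalues of `R B Rᵀ`. -/
lemma log_det_sub_log_det_le (hA : A.PosDef) (hB : B.PosDef) :
    Real.log B.det - Real.log A.det ≤ (A⁻¹ * B).trace - n := by
  obtain ⟨R, hR, h⟩ := exists_eq_transpose_mul_self hA.inv
  have hP : (R * B * Rᵀ).PosDef := by
    have := (Matrix.IsUnit.posDef_star_right_conjugate_iff hR).2 hB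
    simpa [Matrix.star_eq_conjTranspose, Matrix.conjTranspose_eq_transpose_of_trivial] using this
  have h1 := log_det_le_trace_sub hP
  have h2 : (R * B * Rᵀ).trace = (A⁻¹ * B).trace := by
    rw [h, Matrix.trace_mul_comm, Matrix.mul_assoc]
  have h3 : (R * B * Rᵀ).det = B.det / A.det := by
    have : (A⁻¹).det = R.det * R.det := by rw [h, Matrix.det_mul, Matrix.det_transpose]
    rw [Matrix.det_nonsing_inv, Ring.inverse_eq_inv'] at this
    rw [Matrix.det_mul, Matrix.det_mul, Matrix.det_transpose, div_eq_mul_inv, this]; ring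
  rw [h2, h3, Real.log_div hB.det_pos.ne' hA.det_pos.ne'] at h1
  exact h1

/-- With `A = RᵀR` and `B = SᵀS`, the trace is the squared Frobenius norm of `S C Rᵀ`. -/
lemma trace_mul_mul_mul_nonneg (hA : A.PosDef) (hB : B.PosDef) (hC : C.IsHermitian) :
    0 ≤ (A * C * B * C).trace ∧ ((A * C * B * C).trace = 0 → C = 0) := by
  obtain ⟨R, hR, rfl⟩ := exists_eq_transpose_mul_self hA
  obtain ⟨S, hS, rfl⟩ := exists_eq_transpose_mul_self hB
  have hC' : Cᵀ = C := by
    rw [← Matrix.conjTranspose_eq_transpose_of_trivial]; exact hC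
  have h : (Rᵀ * R * C * (Sᵀ * S) * C).trace = ((S * C * Rᵀ)ᴴ * (S * C * Rᵀ)).trace := by
    rw [Matrix.conjTranspose_eq_transpose_of_trivial, Matrix.transpose_mul, Matrix.transpose_mul,
      Matrix.transpose_transpose, hC']
    simp only [Matrix.mul_assoc]
    rw [Matrix.trace_mul_comm]
    simp only [Matrix.mul_assoc]
  rw [h]
  refine ⟨(Matrix.posSemidef_conjTranspose_mul_self _).trace_nonneg, fun h0 => ?_⟩
  rw [Matrix.trace_conjTranspose_mul_self_eq_zero_iff] at h0
  have hRt : IsUnit Rᵀ := (Matrix.isUnit_transpose R).2 hR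
  rw [hRt.mul_left_eq_zero, hS.mul_right_eq_zero] at h0
  exact h0

end PosDef

/-! ### One-variable estimates for the three kinds of step -/

section Scalar

lemma sq_le_decrease_of_ascent {n κ : ℝ} (hn : 0 < n) (h : n ≤ κ) :
    ((n - κ) / κ) ^ 2 / 4 ≤
      Real.log (1 + (κ - n) / κ ^ 2 * κ) - n * ((κ - n) / κ ^ 2) := by
  have hκ : 0 < κ := hn.trans_le h
  -- The decrease is `ln (1 + s) - (1 - s) s`, and `ln (1 + s) ≥ s - s² / 2`.
  obtain ⟨s, hs⟩ : ∃ s, s = (κ - n) / κ := ⟨_, rfl⟩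
  have hs0 : 0 ≤ s := hs ▸ div_nonneg (sub_nonneg.2 h) hκ.le
  have h1 : (κ - n) / κ ^ 2 * κ = s := by rw [hs]; field_simp
  have h2 : n * ((κ - n) / κ ^ 2) = (1 - s) * s := by rw [hs]; field_simp; ring
  have h3 : (n - κ) / κ = -s := by rw [hs]; ring
  have h4 := Real.le_log_one_add_of_nonneg hs0
  have h5 : s - s ^ 2 / 2 ≤ 2 * s / (s + 2) := by
    rw [le_div_iff₀ (by positivity)]
    nlinarith [mul_nonneg hs0 (sq_nonneg s)]
  rw [h1, h2, h3]
  nlinarith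

lemma sq_le_decrease_of_descent {n κ : ℝ} (hκ : 0 < κ) (h : κ ≤ n) :
    ((n - κ) / n) ^ 2 / 4 ≤
      Real.log (1 - (n - κ) / (n * κ) * κ) + n * ((n - κ) / (n * κ)) := by
  have hn : 0 < n := hκ.trans_le h
  -- The square root matters: `ln t² ≥ 2 (1 - 1/t)` bounds the decrease below by the square `(1 -
  -- 1/t)²`, whereas `ln t² ≥ 1 - 1/t²` would only give `0`.
  obtain ⟨t, ht⟩ : ∃ t, t = √(κ / n) := ⟨_, rfl⟩
  have ht0 : 0 < t := ht ▸ Real.sqrt_pos.2 (div_pos hκ hn)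
  have htt : t ^ 2 = κ / n := by rw [ht, Real.sq_sqrt (div_pos hκ hn).le]
  have hκt : κ = t ^ 2 * n := by rw [htt]; field_simp
  have ht1 : t ≤ 1 := by
    rw [ht]; exact Real.sqrt_le_one.2 ((div_le_one hn).2 h)
  have h1 : 1 - (n - κ) / (n * κ) * κ = t ^ 2 := by rw [htt]; field_simp; ring
  have h2 : n * ((n - κ) / (n * κ)) = 1 / t ^ 2 - 1 := by rw [htt]; field_simp
  have h3 : (n - κ) / n = 1 - t ^ 2 := by rw [htt]; field_simp
  have h4 := Real.one_sub_inv_le_log_of_pos ht0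
  rw [h1, h2, h3, Real.log_pow]
  have h5 : (1 - t ^ 2) ^ 2 / 4 ≤ (1 - t⁻¹) ^ 2 := by
    have : (1 - t⁻¹) ^ 2 = (1 - t) ^ 2 / t ^ 2 := by field_simp; ring
    rw [this, le_div_iff₀ (by positivity)]
    have h6 : (t * (1 + t)) ^ 2 ≤ 2 ^ 2 := by
      apply pow_le_pow_left₀ (by positivity); nlinarith
    nlinarith [mul_le_mul_of_nonneg_left h6 (sq_nonneg (1 - t))]
  have h7 : (1 - t⁻¹) ^ 2 = 1 - 2 * t⁻¹ + 1 / t ^ 2 := by field_simp; ring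
  push_cast
  linarith

lemma log_add_pos_of_drop {n κ u : ℝ} (hn : 0 < n) (hu : 0 < u) (hκ : 0 ≤ κ)
    (h : u * (n * κ) < n - κ) :
    0 < 1 - u * κ ∧ 0 < Real.log (1 - u * κ) + n * u := by
  have h1 : 0 < 1 - u * κ := by
    by_contra! hc
    nlinarith
  refine ⟨h1, ?_⟩
  have h2 := Real.one_sub_inv_le_log_of_pos h1
  have h3 : 1 - (1 - u * κ)⁻¹ + n * u = u * (n * (1 - u * κ) - κ) / (1 - u * κ) := by
    field_simp; ring
  have h4 : 0 < u * (n * (1 - u * κ) - κ) / (1 - u * κ) := by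
    apply div_pos (mul_pos hu _) h1
    linarith
  linarith

end Scalar

/-! ### Descent and change of support in one step -/

section Step

variable {n m : ℕ} (X : Matrix (Fin n) (Fin m) ℝ)

/-- The objective function `h(u) = - ln det (X U Xᵀ) + n (eᵀ u - 1)`. -/
noncomputable def objective (u : Fin m → ℝ) : ℝ :=
  -Real.log (gram X u).det + n * (∑ i, u i - 1)

variable {X}

lemma feasible_update {u : Fin m → ℝ} (hu : Feasible X u) {j : Fin m} {c : ℝ} (hc : 0 ≤ c)
    (hpos : 0 < 1 + (c - u j) * kappa X u j) : Feasible X (Function.update u j c) := by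
  rw [feasible_iff, det_gram_update X hu.2.det_pos.ne']
  refine ⟨fun i => ?_, mul_pos hu.2.det_pos hpos⟩
  by_cases h : i = j
  · subst h; simpa using hc
  · simpa [h] using hu.1 i

lemma objective_update {u : Fin m → ℝ} (hu : Feasible X u) {j : Fin m} {c : ℝ}
    (hpos : 0 < 1 + (c - u j) * kappa X u j) :
    objective X (Function.update u j c) =
      objective X u - Real.log (1 + (c - u j) * kappa X u j) + n * (c - u j) := by
  rw [objective, objective, det_gram_update X hu.2.det_pos.ne',
    Real.log_mul hu.2.det_pos.ne' hpos.ne', Finset.sum_update_of_mem (Finset.mem_univ j),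
    ← Finset.add_sum_erase _ _ (Finset.mem_univ j), Finset.sdiff_singleton_eq_erase]
  ring

variable (X) in
/-- The step in coordinate `j` truncates at zero. -/
def IsDrop (u : Fin m → ℝ) (j : Fin m) : Prop :=
  kappa X u j < n ∧ u j * (n * kappa X u j) < n - kappa X u j

lemma newValue_of_isDrop {u : Fin m → ℝ} {j : Fin m} (h : IsDrop X u j) :
    newValue X u j = 0 := by
  rw [newValue, if_neg h.1.not_ge, if_neg h.2.not_ge]

lemma drop_step (hn : 0 < n) {u : Fin m → ℝ} (hu : Feasible X u) {j : Fin m} (hj : Movable X u j)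
    (h : IsDrop X u j) :
    0 < u j ∧ Feasible X (Function.update u j (newValue X u j)) ∧
      objective X (Function.update u j (newValue X u j)) < objective X u := by
  have hn' : (0 : ℝ) < n := by exact_mod_cast hn
  have huj : 0 < u j := hj.resolve_right h.1.not_gt
  obtain ⟨h1, h2⟩ := log_add_pos_of_drop hn' huj (kappa_nonneg X hu j) h.2
  have h3 : 1 + (0 - u j) * kappa X u j = 1 - u j * kappa X u j := by ring
  rw [newValue_of_isDrop h]
  refine ⟨huj, feasible_update hu le_rfl (h3 ▸ h1), ?_⟩
  rw [objective_update hu (h3 ▸ h1), h3]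
  linarith

lemma full_step (hn : 0 < n) {u : Fin m → ℝ} (hu : Feasible X u) {j : Fin m}
    (h : ¬ IsDrop X u j) {B : ℝ} (hnB : n ≤ B) (hB : kappa X u j ≤ B) :
    Feasible X (Function.update u j (newValue X u j)) ∧
      objective X (Function.update u j (newValue X u j)) ≤
        objective X u - (gradH X u j) ^ 2 / (4 * B ^ 2) := by
  have hn' : (0 : ℝ) < n := by exact_mod_cast hn
  have hBpos : 0 < B := hn'.trans_le hnB
  have key : ∀ d : ℝ, 0 < d → d ≤ B →
      (gradH X u j) ^ 2 / (4 * B ^ 2) ≤ ((n - kappa X u j) / d) ^ 2 / 4 := fun d hd hdB => by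
    rw [gradH, div_pow, div_div, mul_comm (d ^ 2)]
    gcongr
  by_cases hκ : (n : ℝ) ≤ kappa X u j
  · have hκ0 := hn'.trans_le hκ
    have hv : newValue X u j - u j = (kappa X u j - n) / kappa X u j ^ 2 := by
      rw [newValue, if_pos hκ]; ring
    have h0 : 0 ≤ (kappa X u j - n) / kappa X u j ^ 2 :=
      div_nonneg (sub_nonneg.2 hκ) (sq_nonneg _)
    have hpos : 0 < 1 + (newValue X u j - u j) * kappa X u j := by
      rw [hv]; positivity
    refine ⟨feasible_update hu (by linarith [hu.1 j]) hpos, ?_⟩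
    rw [objective_update hu hpos, hv]
    linarith [sq_le_decrease_of_ascent hn' hκ, key _ hκ0 hB]
  · push Not at hκ
    have hle : n - kappa X u j ≤ u j * (n * kappa X u j) := by
      by_contra! hc
      exact h ⟨hκ, hc⟩
    -- For `κⱼ = 0` the division-free test would read `n ≤ 0`, so that case is a drop.
    have hκ0 : 0 < kappa X u j := by
      refine (kappa_nonneg X hu j).lt_of_ne fun h0 => ?_
      rw [← h0] at hle
      simp only [sub_zero, mul_zero] at hle
      linarith
    have hv : newValue X u j - u j = -((n - kappa X u j) / (n * kappa X u j)) := by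
      rw [newValue, if_neg hκ.not_ge, if_pos hle]; ring
    have hc : 0 ≤ newValue X u j := by
      have : (n - kappa X u j) / (n * kappa X u j) ≤ u j := by
        rwa [div_le_iff₀ (by positivity)]
      linarith
    have hpos : 0 < 1 + (newValue X u j - u j) * kappa X u j := by
      have : 1 + (newValue X u j - u j) * kappa X u j = kappa X u j / n := by
        rw [hv]; field_simp; ring
      rw [this]; positivity
    refine ⟨feasible_update hu hc hpos, ?_⟩
    rw [objective_update hu hpos, hv, neg_mul, ← sub_eq_add_neg]
    linarith [sq_le_decrease_of_descent hκ0 hκ.le, key _ hn' hnB]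

/-- The support of a weight vector. -/
noncomputable def supp (u : Fin m → ℝ) : Finset (Fin m) := by
  classical exact Finset.univ.filter fun i => u i ≠ 0

lemma card_supp_update_le (u : Fin m → ℝ) (j : Fin m) (c : ℝ) :
    (supp (Function.update u j c)).card ≤ (supp u).card + 1 := by
  classical
  refine (Finset.card_le_card fun i hi => ?_).trans (Finset.card_insert_le j (supp u))
  by_cases h : i = j
  · simp [h]
  · simpa [supp, h] using hi

lemma card_supp_update_zero {u : Fin m → ℝ} {j : Fin m} (hj : u j ≠ 0) :
    (supp (Function.update u j 0)).card + 1 = (supp u).card := by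
  classical
  have h : supp (Function.update u j 0) = (supp u).erase j := by
    ext i
    by_cases h : i = j
    · simp [supp, h]
    · simp [supp, h]
  rw [h, Finset.card_erase_add_one]
  simpa [supp] using hj

lemma card_supp_le (u : Fin m → ℝ) : (supp u).card ≤ m := by
  simpa using Finset.card_le_univ (supp u)

end Step

/-! ### Compact level sets and existence of a KKT minimizer -/

section LevelSet

variable {n m : ℕ} (X : Matrix (Fin n) (Fin m) ℝ)

/-- The determinant is homogeneous of degree `n` in `u` and bounded on the simplex. -/
lemma exists_det_gram_le :
    ∃ C : ℝ, 0 < C ∧ ∀ u : Fin m → ℝ, (∀ i, 0 ≤ u i) → 0 < ∑ i, u i →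
      (gram X u).det ≤ C * (∑ i, u i) ^ n := by
  obtain ⟨C, hC⟩ := ((isCompact_stdSimplex ℝ (Fin m)).image
    (continuous_gram X).matrix_det).bddAbove
  refine ⟨max C 1, by positivity, fun u hu hs => ?_⟩
  obtain ⟨s, hsdef⟩ : ∃ s, s = ∑ i, u i := ⟨_, rfl⟩
  rw [← hsdef] at hs ⊢
  have hmem : s⁻¹ • u ∈ stdSimplex ℝ (Fin m) := by
    refine ⟨fun i => mul_nonneg (inv_nonneg.2 hs.le) (hu i), ?_⟩
    simp only [Pi.smul_apply, smul_eq_mul, ← Finset.mul_sum, ← hsdef]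
    exact inv_mul_cancel₀ hs.ne'
  have h1 : (gram X (s⁻¹ • u)).det ≤ max C 1 :=
    (hC (Set.mem_image_of_mem _ hmem)).trans (le_max_left _ _)
  have h2 : u = s • (s⁻¹ • u) := by rw [smul_smul, mul_inv_cancel₀ hs.ne', one_smul]
  rw [h2, gram_smul, Matrix.det_smul, Fintype.card_fin, mul_comm]
  gcongr

/-- Weights of bounded sum whose Gram matrix has determinant bounded away from zero. -/
def region (K d : ℝ) : Set (Fin m → ℝ) :=
  {u | (∀ i, 0 ≤ u i) ∧ ∑ i, u i ≤ K ∧ d ≤ (gram X u).det}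

lemma isCompact_region (K d : ℝ) : IsCompact (region X K d) := by
  refine (isCompact_Icc (a := (0 : Fin m → ℝ)) (b := fun _ => K)).of_isClosed_subset ?_ ?_
  · have h1 : IsClosed {u : Fin m → ℝ | ∀ i, 0 ≤ u i} := by
      simp only [Set.ofPred_forall]
      exact isClosed_iInter fun i => isClosed_le continuous_const (continuous_apply i)
    have h2 : IsClosed {u : Fin m → ℝ | ∑ i, u i ≤ K} :=
      isClosed_le (by fun_prop) continuous_const
    have h3 : IsClosed {u : Fin m → ℝ | d ≤ (gram X u).det} :=
      isClosed_le continuous_const (continuous_gram X).matrix_det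
    exact h1.inter (h2.inter h3)
  · rintro u ⟨h1, h2, -⟩
    exact ⟨h1, fun i => (Finset.single_le_sum (fun i _ => h1 i) (Finset.mem_univ i)).trans h2⟩

variable {X}

lemma feasible_of_mem_region {K d : ℝ} (hd : 0 < d) {u : Fin m → ℝ} (hu : u ∈ region X K d) :
    Feasible X u :=
  (feasible_iff X u).2 ⟨hu.1, hd.trans_le hu.2.2⟩

variable (X)

/-- With `s = eᵀu`, `ln det` grows at most like `n ln s`, so the linear term `n s` bounds `s` on a
level set; `s ≥ 0` then bounds the determinant from below. -/
lemma exists_level_set_subset_region (hn : 0 < n) (H : ℝ) :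
    ∃ K d : ℝ, 0 < K ∧ 0 < d ∧
      ∀ u, Feasible X u → objective X u ≤ H → u ∈ region X K d := by
  have hn' : (0 : ℝ) < n := by exact_mod_cast hn
  obtain ⟨C, hC, hdet⟩ := exists_det_gram_le X
  refine ⟨max 1 (2 * (H + Real.log C + n * Real.log 2) / n), Real.exp (-n - H),
    lt_max_of_lt_left one_pos, Real.exp_pos _, fun u hu hH => ?_⟩
  have hs0 : 0 ≤ ∑ i, u i := Finset.sum_nonneg fun i _ => hu.1 i
  have hs : 0 < ∑ i, u i := by
    refine hs0.lt_of_ne' fun h => ?_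
    have h0 := (Finset.sum_eq_zero_iff_of_nonneg fun i _ => hu.1 i).1 h
    have h1 := sum_mul_kappa_self X hu
    rw [Finset.sum_eq_zero fun i hi => by rw [h0 i hi, zero_mul]] at h1
    exact hn'.ne h1
  have hpos := hu.2.det_pos
  obtain ⟨s, hsdef⟩ : ∃ s, s = ∑ i, u i := ⟨_, rfl⟩
  have h1 := hdet u hu.1 hs
  rw [objective] at hH
  refine ⟨hu.1, ?_, ?_⟩
  · rw [← hsdef] at hs hH ⊢
    rw [← hsdef] at h1
    have h2 : Real.log (gram X u).det ≤ Real.log C + n * Real.log s := by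
      have := Real.log_le_log hpos h1
      rwa [Real.log_mul hC.ne' (pow_pos hs n).ne', Real.log_pow] at this
    have h3 : Real.log s ≤ s / 2 - 1 + Real.log 2 := by
      have := Real.log_le_sub_one_of_pos (half_pos hs)
      rw [Real.log_div hs.ne' two_ne_zero] at this
      linarith
    have h4 := mul_le_mul_of_nonneg_left h3 hn'.le
    refine le_max_of_le_right ?_
    rw [le_div_iff₀ hn']
    nlinarith
  · rw [← Real.le_log_iff_exp_le hpos]
    nlinarith

lemma continuousOn_gram_inv : ContinuousOn (fun u => (gram X u)⁻¹) {u | 0 < (gram X u).det} := by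
  intro u hu
  refine ContinuousAt.continuousWithinAt ?_
  refine ContinuousAt.comp (g := Inv.inv) ?_ (continuous_gram X).continuousAt
  refine continuousAt_matrix_inv _ ?_
  rw [Ring.inverse_eq_inv']
  exact continuousAt_inv₀ (ne_of_gt hu)

lemma continuousOn_kappa (i : Fin m) :
    ContinuousOn (fun u => kappa X u i) {u | 0 < (gram X u).det} := by
  have h : Continuous fun M : Matrix (Fin n) (Fin n) ℝ => X.col i ⬝ᵥ (M *ᵥ X.col i) :=
    continuous_const.dotProduct (continuous_id.matrix_mulVec continuous_const)
  exact h.comp_continuousOn (continuousOn_gram_inv X)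

lemma region_subset {K d : ℝ} (hd : 0 < d) : region X K d ⊆ {u | 0 < (gram X u).det} :=
  fun _ hu => hd.trans_le hu.2.2

lemma exists_kappa_le {K d : ℝ} (hd : 0 < d) :
    ∃ B : ℝ, n ≤ B ∧ ∀ u ∈ region X K d, ∀ i, kappa X u i ≤ B := by
  have h : ∀ i, ∃ B, ∀ u ∈ region X K d, kappa X u i ≤ B := fun i => by
    obtain ⟨B, hB⟩ := ((isCompact_region X K d).image_of_continuousOn
      ((continuousOn_kappa X i).mono (region_subset X hd))).bddAbove
    exact ⟨B, fun u hu => hB (Set.mem_image_of_mem _ hu)⟩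
  choose B hB using h
  obtain ⟨B', hB'⟩ := (Set.finite_range B).bddAbove
  exact ⟨max n B', le_max_left _ _, fun u hu i =>
    (hB i u hu).trans ((hB' (Set.mem_range_self i)).trans (le_max_right _ _))⟩

/-- The Karush-Kuhn-Tucker conditions for minimizing `h` over `u ≥ 0`. -/
def IsKKT (u : Fin m → ℝ) : Prop :=
  Feasible X u ∧ (∀ i, kappa X u i ≤ n) ∧ ∀ i, 0 < u i → kappa X u i = n

/-- If a condition failed at coordinate `i`, the algorithm's own step there would lower the
objective, so `h` need not be differentiated. -/
lemma isKKT_of_minimizer (hn : 0 < n) {u : Fin m → ℝ} (hu : Feasible X u)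
    (hmin : ∀ v, Feasible X v → objective X u ≤ objective X v) : IsKKT X u := by
  have hn' : (0 : ℝ) < n := by exact_mod_cast hn
  have full : ∀ j B, ¬ IsDrop X u j → (n : ℝ) ≤ B → kappa X u j ≤ B → kappa X u j = n :=
    fun j B hj hnB hB => by
      obtain ⟨h1, h2⟩ := full_step hn hu hj hnB hB
      have h3 := hmin _ h1
      have hBpos : 0 < B := hn'.trans_le hnB
      by_contra hne
      have h4 : 0 < (gradH X u j) ^ 2 / (4 * B ^ 2) := by
        have : gradH X u j ≠ 0 := sub_ne_zero.2 (Ne.symm hne)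
        positivity
      linarith
  refine ⟨hu, fun i => ?_, fun i hi => ?_⟩
  · by_contra! h
    exact h.ne' (full i _ (fun hd => hd.1.not_gt h) h.le le_rfl)
  · by_cases hd : IsDrop X u i
    · obtain ⟨-, h1, h2⟩ := drop_step hn hu (Or.inl hi) hd
      exact absurd (hmin _ h1) h2.not_ge
    · exact full i _ hd (le_max_left _ _) (le_max_right _ _)

lemma exists_minimizer (hn : 0 < n) {u₀ : Fin m → ℝ} (hu₀ : Feasible X u₀) :
    ∃ u, IsKKT X u ∧ ∀ v, Feasible X v → objective X u ≤ objective X v := by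
  obtain ⟨K, d, -, hd, h⟩ := exists_level_set_subset_region X hn (objective X u₀)
  have hcont : ContinuousOn (objective X) (region X K d) := by
    unfold objective
    refine ContinuousOn.add (ContinuousOn.neg (ContinuousOn.log ?_ ?_)) (by fun_prop)
    · exact (continuous_gram X).matrix_det.continuousOn
    · exact fun u hu => (hd.trans_le hu.2.2).ne'
  obtain ⟨u, hu, hmin⟩ := (isCompact_region X K d).exists_isMinOn ⟨u₀, h u₀ hu₀ le_rfl⟩ hcont
  have hfu := feasible_of_mem_region hd hu
  have hmin' : ∀ v, Feasible X v → objective X u ≤ objective X v := fun v hv => by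
    rcases le_total (objective X v) (objective X u₀) with hle | hle
    · exact hmin (h v hv hle)
    · exact (hmin (h u₀ hu₀ le_rfl)).trans hle
  exact ⟨u, isKKT_of_minimizer X hn hfu hmin', hmin'⟩

end LevelSet

/-! ### A Hoffman-type bound from sign patterns and compactness -/

section Hoffman

open Filter Topology

variable {m : ℕ}

/-- The closed cone of vectors whose signs agree with `σ`. -/
def signCone (σ : Fin m → SignType) : Set (Fin m → ℝ) :=
  {v | ∀ i, |v i| = (σ i : ℝ) * v i}

lemma isClosed_signCone (σ : Fin m → SignType) : IsClosed (signCone σ) := by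
  simp only [signCone, Set.ofPred_forall]
  exact isClosed_iInter fun i => isClosed_eq (by fun_prop) (by fun_prop)

lemma smul_mem_signCone {σ : Fin m → SignType} {v : Fin m → ℝ} (hv : v ∈ signCone σ) {t : ℝ}
    (ht : 0 ≤ t) : t • v ∈ signCone σ := fun i => by
  simp only [Pi.smul_apply, smul_eq_mul, abs_mul, abs_of_nonneg ht, hv i]
  ring

lemma mem_signCone_sign (v : Fin m → ℝ) : v ∈ signCone fun i => SignType.sign (v i) :=
  fun i => (sign_mul_self (v i)).symm

/-- Among the vectors between `0` and `d` that agree with `d` modulo `W`, one of minimal `ℓ¹`-norm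
has a sign cone that meets `W` only in zero. -/
lemma exists_conformal (W : Submodule ℝ (Fin m → ℝ)) (d : Fin m → ℝ) :
    ∃ d' : Fin m → ℝ, d' - d ∈ W ∧ (∀ i, d' i ∈ Set.uIcc 0 (d i)) ∧
      ∀ z ∈ W, z ∈ signCone (fun i => SignType.sign (d' i)) → z = 0 := by
  have hcomp : IsCompact ((Set.univ.pi fun i => Set.uIcc 0 (d i)) ∩ {v | v - d ∈ W}) := by
    refine (isCompact_univ_pi fun i => isCompact_uIcc).inter_right ?_
    exact W.closed_of_finiteDimensional.preimage (continuous_id.sub continuous_const)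
  obtain ⟨d', ⟨hbox, hW⟩, hmin⟩ := hcomp.exists_isMinOn (f := fun v => ∑ i, |v i|)
    ⟨d, fun i _ => Set.right_mem_uIcc, by simp⟩ (by fun_prop)
  refine ⟨d', hW, fun i => hbox i trivial, fun z hz hcone => ?_⟩
  by_contra hne
  -- For small `t > 0`, `d' - t z` stays in the box and in the class modulo `W`, but its `ℓ¹`-norm
  -- is smaller by `t ‖z‖₁`, contradicting minimality.
  have hev : ∀ᶠ t : ℝ in 𝓝[>] 0, ∀ i, t * |z i| ≤ |d' i| := by
    rw [eventually_all]
    intro i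
    by_cases h0 : d' i = 0
    · have h1 := hcone i
      simp only [h0, sign_zero, SignType.coe_zero, zero_mul] at h1
      exact Eventually.of_forall fun t => by simp [h0, h1]
    · have h1 : Tendsto (fun t : ℝ => t * |z i|) (𝓝[>] 0) (𝓝 (0 * |z i|)) :=
        ((continuous_id.mul continuous_const).tendsto 0).mono_left nhdsWithin_le_nhds
      rw [zero_mul] at h1
      exact (h1.eventually (gt_mem_nhds (abs_pos.2 h0))).mono fun t ht => ht.le
  obtain ⟨t, ht, ht0⟩ := (hev.and self_mem_nhdsWithin).exists
  have ht0 : 0 < t := ht0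
  have habs : ∀ i, |d' i - t * z i| = |d' i| - t * |z i| ∧
      d' i - t * z i ∈ Set.uIcc 0 (d i) := fun i => by
    have h1 := hcone i
    have h2 := ht i
    have h3 := hbox i trivial
    rcases lt_trichotomy (d' i) 0 with h | h | h
    · simp only [sign_neg h, SignType.coe_neg_one, neg_mul, one_mul] at h1
      rw [h1, abs_of_neg h] at h2 ⊢
      have h4 : z i ≤ 0 := by linarith [abs_nonneg (z i)]
      have h5 : t * z i ≤ 0 := mul_nonpos_of_nonneg_of_nonpos ht0.le h4
      rw [abs_of_nonpos (by linarith)]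
      refine ⟨by ring, ?_⟩
      rw [Set.mem_uIcc] at h3 ⊢
      right
      rcases h3 with h3 | h3
      · linarith
      · constructor <;> linarith
    · simp only [h, sign_zero, SignType.coe_zero, zero_mul] at h1
      rw [abs_eq_zero.1 h1, h]
      simp
    · simp only [sign_pos h, SignType.coe_one, one_mul] at h1
      rw [h1, abs_of_pos h] at h2 ⊢
      have h4 : 0 ≤ z i := by linarith [abs_nonneg (z i)]
      have h5 : 0 ≤ t * z i := mul_nonneg ht0.le h4
      rw [abs_of_nonneg (by linarith)]
      refine ⟨by ring, ?_⟩
      rw [Set.mem_uIcc] at h3 ⊢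
      left
      rcases h3 with h3 | h3
      · constructor <;> linarith
      · linarith
  have hle : ∑ i, |d' i| ≤ ∑ i, |(d' - t • z) i| := hmin ⟨fun i _ => (habs i).2, by
    have : d' - t • z - d = (d' - d) - t • z := by abel
    rw [Set.mem_ofPred_eq, this]
    exact W.sub_mem hW (W.smul_mem t hz)⟩
  simp only [Pi.sub_apply, Pi.smul_apply, smul_eq_mul, (habs _).1, Finset.sum_sub_distrib,
    ← Finset.mul_sum] at hle
  have : 0 < ∑ i, |z i| := by
    obtain ⟨i, hi⟩ := Function.ne_iff.1 hne
    exact Finset.sum_pos' (fun i _ => abs_nonneg _) ⟨i, Finset.mem_univ i, abs_pos.2 hi⟩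
  nlinarith

/-- `F` is positive on the compact product of `D` with the unit vectors of the cone; homogeneity
extends its minimum there. -/
lemma exists_coercive_on_signCone {W : Submodule ℝ (Fin m → ℝ)} {D : Set (Fin m → ℝ)}
    (hD : IsCompact D) {F : (Fin m → ℝ) → (Fin m → ℝ) → ℝ}
    (hF : ContinuousOn (fun p : (Fin m → ℝ) × (Fin m → ℝ) => F p.1 p.2) (D ×ˢ Set.univ))
    (hhom : ∀ u v, ∀ t : ℝ, F u (t • v) = t ^ 2 * F u v)
    (hW : ∀ u ∈ D, ∀ v, F u v ≤ 0 → v ∈ W) (σ : Fin m → SignType)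
    (hσ : ∀ z ∈ W, z ∈ signCone σ → z = 0) :
    ∃ c : ℝ, 0 < c ∧ ∀ u ∈ D, ∀ v ∈ signCone σ, c * ‖v‖ ^ 2 ≤ F u v := by
  have hcomp : IsCompact (D ×ˢ (Metric.sphere (0 : Fin m → ℝ) 1 ∩ signCone σ)) :=
    hD.prod ((isCompact_sphere _ _).inter_right (isClosed_signCone σ))
  obtain ⟨c, hc, hmin⟩ : ∃ c : ℝ, 0 < c ∧
      ∀ p ∈ D ×ˢ (Metric.sphere (0 : Fin m → ℝ) 1 ∩ signCone σ), c ≤ F p.1 p.2 := by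
    rcases Set.eq_empty_or_nonempty (D ×ˢ (Metric.sphere (0 : Fin m → ℝ) 1 ∩ signCone σ))
      with he | hne
    · exact ⟨1, one_pos, by simp [he]⟩
    · obtain ⟨p, hp, hmin⟩ := hcomp.exists_isMinOn hne
        (hF.mono (Set.prod_mono_right (Set.subset_univ _)))
      refine ⟨F p.1 p.2, ?_, fun q hq => hmin hq⟩
      by_contra! hle
      have h0 := hσ _ (hW _ hp.1 _ hle) hp.2.2
      have h1 := hp.2.1
      rw [h0] at h1
      simp at h1
  refine ⟨c, hc, fun u hu v hv => ?_⟩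
  by_cases h0 : v = 0
  · subst h0
    have h1 := hhom u 0 0
    rw [smul_zero, zero_pow two_ne_zero, zero_mul] at h1
    rw [h1, norm_zero, zero_pow two_ne_zero, mul_zero]
  · have hv0 : 0 < ‖v‖ := norm_pos_iff.2 h0
    have h1 := hmin (u, ‖v‖⁻¹ • v) ⟨hu, by simp [norm_smul, hv0.ne'],
      smul_mem_signCone hv (inv_nonneg.2 hv0.le)⟩
    simp only [hhom] at h1
    rw [inv_pow, inv_mul_eq_div, le_div_iff₀ (by positivity)] at h1
    exact h1

/-- A bound of Hoffman's type: a displacement `d` can be replaced by one between `0` and `d`, equal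
to `d` modulo `W`, on which a quadratic form vanishing only on `W` is coercive. -/
lemma exists_hoffman_bound {W : Submodule ℝ (Fin m → ℝ)} {D : Set (Fin m → ℝ)}
    (hD : IsCompact D) {F : (Fin m → ℝ) → (Fin m → ℝ) → ℝ}
    (hF : ContinuousOn (fun p : (Fin m → ℝ) × (Fin m → ℝ) => F p.1 p.2) (D ×ˢ Set.univ))
    (hhom : ∀ u v, ∀ t : ℝ, F u (t • v) = t ^ 2 * F u v)
    (hW : ∀ u ∈ D, ∀ v, F u v ≤ 0 → v ∈ W) :
    ∃ c : ℝ, 0 < c ∧ ∀ u ∈ D, ∀ d : Fin m → ℝ, ∃ d' : Fin m → ℝ,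
      d' - d ∈ W ∧ (∀ i, d' i ∈ Set.uIcc 0 (d i)) ∧ c * ‖d'‖ ^ 2 ≤ F u d' := by
  have h : ∀ σ : Fin m → SignType, ∃ c : ℝ, 0 < c ∧ ((∀ z ∈ W, z ∈ signCone σ → z = 0) →
      ∀ u ∈ D, ∀ v ∈ signCone σ, c * ‖v‖ ^ 2 ≤ F u v) := fun σ => by
    by_cases hσ : ∀ z ∈ W, z ∈ signCone σ → z = 0
    · obtain ⟨c, hc, h⟩ := exists_coercive_on_signCone hD hF hhom hW σ hσ
      exact ⟨c, hc, fun _ => h⟩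
    · exact ⟨1, one_pos, fun h => absurd h hσ⟩
  choose c hc hcF using h
  -- There are finitely many sign patterns, so one constant serves all.
  obtain ⟨σ₀, hσ₀⟩ := Finite.exists_min c
  refine ⟨c σ₀, hc σ₀, fun u hu d => ?_⟩
  obtain ⟨d', h1, h2, h3⟩ := exists_conformal W d
  refine ⟨d', h1, h2, le_trans ?_ (hcF _ h3 u hu d' (mem_signCone_sign d'))⟩
  gcongr
  exact hσ₀ _

end Hoffman

/-! ### The gap is at most quadratic in the gradient -/

section ErrorBound

variable {n m : ℕ} (X : Matrix (Fin n) (Fin m) ℝ)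

/-- The displacements that change neither `X U Xᵀ` nor `eᵀ u`. -/
def invariantDirections : Submodule ℝ (Fin m → ℝ) where
  carrier := {v | gram X v = 0 ∧ ∑ i, v i = 0}
  add_mem' := fun {u v} hu hv => ⟨by rw [gram_add, hu.1, hv.1, add_zero], by
    simp [Finset.sum_add_distrib, hu.2, hv.2]⟩
  zero_mem' := ⟨by ext; simp [gram_apply], by simp⟩
  smul_mem' := fun c v hv => ⟨by rw [gram_smul, hv.1, smul_zero], by
    simp [← Finset.mul_sum, hv.2]⟩

lemma exists_hoffman_bound_region {us : Fin m → ℝ} (hus : Feasible X us) (K : ℝ) {d : ℝ}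
    (hd : 0 < d) :
    ∃ c : ℝ, 0 < c ∧ ∀ u ∈ region X K d, ∀ v : Fin m → ℝ, ∃ v' : Fin m → ℝ,
      v' - v ∈ invariantDirections X ∧ (∀ i, v' i ∈ Set.uIcc 0 (v i)) ∧
      c * ‖v'‖ ^ 2 ≤
        ((gram X u)⁻¹ * gram X v' * (gram X us)⁻¹ * gram X v').trace + (∑ i, v' i) ^ 2 := by
  refine exists_hoffman_bound (isCompact_region X K d) (F := fun u v =>
    ((gram X u)⁻¹ * gram X v * (gram X us)⁻¹ * gram X v).trace + (∑ i, v i) ^ 2) ?_ ?_ ?_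
  · have h1 : Continuous fun q : Matrix (Fin n) (Fin n) ℝ × (Fin m → ℝ) =>
        (q.1 * gram X q.2 * (gram X us)⁻¹ * gram X q.2).trace + (∑ i, q.2 i) ^ 2 := by
      have hg : Continuous fun q : Matrix (Fin n) (Fin n) ℝ × (Fin m → ℝ) => gram X q.2 :=
        (continuous_gram X).comp continuous_snd
      have h3 := continuous_fst.matrix_mul hg
      have h4 := h3.matrix_mul (continuous_const (y := (gram X us)⁻¹))
      have h5 := (h4.matrix_mul hg).matrix_trace
      exact h5.add ((continuous_finsetSum _ fun i _ =>
        (continuous_apply i).comp continuous_snd).pow 2)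
    have h2 : ContinuousOn (fun p : (Fin m → ℝ) × (Fin m → ℝ) => (gram X p.1)⁻¹)
        (region X K d ×ˢ Set.univ) :=
      ContinuousOn.comp (g := fun u => (gram X u)⁻¹)
        ((continuousOn_gram_inv X).mono (region_subset X hd)) continuousOn_fst fun p hp => hp.1
    have h6 := h1.comp_continuousOn (h2.prodMk continuousOn_snd)
    simpa only [Function.comp_def] using h6
  · intro u v t
    simp only [gram_smul, Pi.smul_apply, smul_eq_mul, ← Finset.mul_sum, Matrix.mul_smul,
      Matrix.smul_mul, Matrix.trace_smul]
    ring
  · intro u hu v hv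
    obtain ⟨h1, h2⟩ := trace_mul_mul_mul_nonneg (feasible_of_mem_region hd hu).2.inv hus.2.inv
      (gram_isHermitian X v)
    have h3 := sq_nonneg (∑ i, v i)
    exact ⟨h2 (by linarith), pow_eq_zero_iff two_ne_zero |>.1 (by linarith)⟩

/-- The optimality gap is bounded by the square of the largest partial derivative in play. -/
lemma exists_gap_le_sq (hn : 0 < n) {us : Fin m → ℝ} (hus : IsKKT X us) {K d : ℝ} (hK : 0 < K)
    (hd : 0 < d) :
    ∃ C : ℝ, 0 < C ∧ ∀ u ∈ region X K d, ∀ g : ℝ, 0 ≤ g →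
      (∀ i, Movable X u i → |gradH X u i| ≤ g) →
        objective X u - objective X us ≤ C * g ^ 2 := by
  have hn' : (1 : ℝ) ≤ n := by exact_mod_cast hn
  obtain ⟨c, hc, hoff⟩ := exists_hoffman_bound_region X hus.1 K hd
  refine ⟨m * (m * (1 + K) / c) + 1, by positivity, fun u hu g hg hgrad => ?_⟩
  have hfu := feasible_of_mem_region hd hu
  obtain ⟨v, ⟨hv1, hv2⟩, hbox, hcoer⟩ := hoff u hu (us - u)
  have hgv : gram X v = gram X us - gram X u := by
    rw [gram_sub, gram_sub] at hv1
    exact sub_eq_zero.1 hv1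
  have hsv : ∑ i, v i = ∑ i, us i - ∑ i, u i := by
    simp only [Pi.sub_apply, Finset.sum_sub_distrib] at hv2
    linarith
  -- Each `uᵢ + vᵢ` lies between `uᵢ` and the minimizer's weight, both nonnegative.
  have hnn : ∀ i, 0 ≤ u i + v i := fun i => by
    have h1 := hbox i
    rw [Pi.sub_apply, Set.mem_uIcc] at h1
    rcases h1 with h1 | h1 <;> linarith [hu.1 i, hus.1.1 i]
  have hkk := sum_mul_kappa_self X hfu
  have hkks := sum_mul_kappa_self X hus.1
  have hsus : (n : ℝ) * ∑ i, us i = n := by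
    rw [← hkks, Finset.mul_sum, hkks]
    refine (Finset.sum_congr rfl fun i _ => ?_).trans hkks
    rcases (hus.1.1 i).eq_or_lt with h | h
    · rw [← h]; ring
    · rw [hus.2.2 i h]; ring
  have hsus1 : ∑ i, us i = 1 := by
    have : (n : ℝ) ≠ 0 := by positivity
    exact mul_left_cancel₀ this (by rw [hsus, mul_one])
  -- The left side is `-∇h(u)·v`. A coordinate not in play has `uᵢ = 0`, so `vᵢ ≥ 0`, and `κᵢ ≤ n`:
  -- it contributes nothing positive.
  have hdir : ∑ i, v i * kappa X u i - n * ∑ i, v i ≤ g * (m * ‖v‖) := by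
    have h1 : ∀ i, v i * kappa X u i - n * v i ≤ g * ‖v‖ := fun i => by
      have h2 : |v i| ≤ ‖v‖ := norm_le_pi_norm v i
      by_cases hm : Movable X u i
      · calc v i * kappa X u i - n * v i = -(gradH X u i * v i) := by rw [gradH]; ring
          _ ≤ |gradH X u i * v i| := neg_le_abs _
          _ ≤ g * ‖v‖ := by
            rw [abs_mul]
            exact mul_le_mul (hgrad i hm) h2 (abs_nonneg _) hg
      · rw [Movable, not_or, not_lt, not_lt] at hm
        have h3 : u i = 0 := le_antisymm hm.1 (hu.1 i)
        have h4 : 0 ≤ v i := by linarith [hnn i]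
        nlinarith [mul_nonneg hg (norm_nonneg v), mul_nonneg h4 (sub_nonneg.2 hm.2)]
    calc _ = ∑ i, (v i * kappa X u i - n * v i) := by
          rw [Finset.sum_sub_distrib, Finset.mul_sum]
      _ ≤ ∑ _i : Fin m, g * ‖v‖ := Finset.sum_le_sum fun i _ => h1 i
      _ = _ := by simp; ring
  have hdirs : 0 ≤ ∑ i, v i * kappa X us i - n * ∑ i, v i := by
    have h1 : ∑ i, v i * kappa X us i = n - ∑ i, u i * kappa X us i := by
      rw [sum_mul_kappa, hgv, Matrix.mul_sub, Matrix.trace_sub, ← sum_mul_kappa, ← sum_mul_kappa,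
        hkks]
    have h2 : ∑ i, u i * kappa X us i ≤ n * ∑ i, u i := by
      rw [Finset.mul_sum]
      refine Finset.sum_le_sum fun i _ => ?_
      rw [mul_comm (n : ℝ)]
      exact mul_le_mul_of_nonneg_left (hus.2.1 i) (hu.1 i)
    rw [h1, hsv, mul_sub, hsus]
    linarith
  -- The resolvent identity `A⁻¹ (B - A) B⁻¹ = A⁻¹ - B⁻¹` makes the quadratic form a difference of
  -- gradients along `v`; `hdir` and `hdirs` then bound it.
  have hquad : ((gram X u)⁻¹ * gram X v * (gram X us)⁻¹ * gram X v).trace =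
      ∑ i, v i * kappa X u i - ∑ i, v i * kappa X us i := by
    have h1 : (gram X u)⁻¹ * gram X v * (gram X us)⁻¹ = (gram X u)⁻¹ - (gram X us)⁻¹ := by
      rw [hgv, Matrix.mul_sub, Matrix.sub_mul, Matrix.nonsing_inv_mul _ hfu.2.det_pos.ne'.isUnit,
        Matrix.mul_nonsing_inv_cancel_right _ _ hus.1.2.det_pos.ne'.isUnit, Matrix.one_mul]
    rw [h1, Matrix.sub_mul, Matrix.trace_sub, ← sum_mul_kappa, ← sum_mul_kappa]
  -- The total weight is controlled separately: both `∑ uᵢ κ(u)ᵢ` and `n` times the minimizer's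
  -- total weight equal `n`.
  have hsum1 : |∑ i, v i| ≤ g * K := by
    have h1 : n * ∑ i, v i = -∑ i, u i * gradH X u i := by
      simp only [gradH, mul_sub, Finset.sum_sub_distrib, hkk, ← Finset.sum_mul]
      rw [hsv, hsus1]; ring
    calc |∑ i, v i| ≤ n * |∑ i, v i| := le_mul_of_one_le_left (abs_nonneg _) hn'
      _ = |∑ i, u i * gradH X u i| := by
        rw [← abs_neg (∑ i, u i * gradH X u i), ← h1, abs_mul, Nat.abs_cast]
      _ ≤ ∑ i, |u i * gradH X u i| := Finset.abs_sum_le_sum_abs _ _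
      _ ≤ ∑ i, g * u i := Finset.sum_le_sum fun i _ => by
        rw [abs_mul, abs_of_nonneg (hu.1 i), mul_comm]
        rcases (hu.1 i).eq_or_lt with h | h
        · simp [← h]
        · exact mul_le_mul_of_nonneg_right (hgrad i (Or.inl h)) h.le
      _ = g * ∑ i, u i := by rw [Finset.mul_sum]
      _ ≤ g * K := mul_le_mul_of_nonneg_left hu.2.1 hg
  have hsum2 : |∑ i, v i| ≤ m * ‖v‖ := by
    calc |∑ i, v i| ≤ ∑ i, |v i| := Finset.abs_sum_le_sum_abs _ _
      _ ≤ ∑ _i : Fin m, ‖v‖ := Finset.sum_le_sum fun i _ => norm_le_pi_norm v i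
      _ = _ := by simp
  have hnorm : ‖v‖ ≤ g * (m * (1 + K) / c) := by
    have h1 : (∑ i, v i) ^ 2 ≤ g * K * (m * ‖v‖) := by
      rw [← sq_abs, sq]
      exact mul_le_mul hsum1 hsum2 (abs_nonneg _) (by positivity)
    have h2 : c * ‖v‖ ^ 2 ≤ g * (m * (1 + K)) * ‖v‖ := by
      rw [hquad] at hcoer
      linarith
    rcases (norm_nonneg v).eq_or_lt with h | h
    · rw [← h]; positivity
    · rw [← mul_div_assoc, le_div_iff₀ hc]
      refine le_of_mul_le_mul_right ?_ h
      linarith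
  have hconv : objective X u - objective X us ≤ ∑ i, v i * kappa X u i - n * ∑ i, v i := by
    have h1 := log_det_sub_log_det_le hfu.2 hus.1.2
    have h2 : ((gram X u)⁻¹ * gram X us).trace = n + ∑ i, v i * kappa X u i := by
      rw [sum_mul_kappa, hgv, Matrix.mul_sub, Matrix.trace_sub,
        Matrix.nonsing_inv_mul _ hfu.2.det_pos.ne'.isUnit]
      simp
    rw [h2] at h1
    rw [objective, objective, hsv]
    linarith
  calc _ ≤ g * (m * ‖v‖) := hconv.trans hdir
    _ ≤ g * (m * (g * (m * (1 + K) / c))) := by gcongr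
    _ ≤ _ := by nlinarith [sq_nonneg g]

end ErrorBound

/-! ### Contraction and counting of steps -/

section Convergence

variable {n m : ℕ} (X : Matrix (Fin n) (Fin m) ℝ)

variable {X} in
lemma lt_abs_gradH_of_not_approxOptimal (hn : 0 < n) {u : Fin m → ℝ} (hu : Feasible X u) {ε : ℝ}
    (hε : 0 < ε) (h : ¬ ApproxOptimal X ε u) : ∃ i, Movable X u i ∧ ε < |gradH X u i| := by
  have hn' : (1 : ℝ) ≤ n := by exact_mod_cast hn
  simp only [ApproxOptimal, PrimalFeasible, hu, true_and, not_and_or, not_forall, not_le] at h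
  rcases h with ⟨i, hi⟩ | ⟨i, hi0, hi⟩
  · refine ⟨i, Or.inr (by nlinarith), ?_⟩
    rw [gradH, abs_sub_comm]
    exact lt_of_lt_of_le (by nlinarith) (le_abs_self _)
  · refine ⟨i, Or.inl hi0, ?_⟩
    rw [gradH]
    exact lt_of_lt_of_le (by nlinarith) (le_abs_self _)

/-- On a level set, a step either drops a point without increasing the objective function, or
reduces the optimality gap by a constant factor. -/
lemma exists_contraction (hn : 0 < n) {us : Fin m → ℝ} (hus : IsKKT X us)
    (hmin : ∀ v, Feasible X v → objective X us ≤ objective X v) (H : ℝ) :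
    ∃ c ρ : ℝ, 0 < c ∧ 0 < ρ ∧ ρ < 1 ∧ ∀ u u', Feasible X u → objective X u ≤ H →
      CDStep X u u' → Feasible X u' ∧
        (((supp u').card + 1 = (supp u).card ∧ objective X u' ≤ objective X u) ∨
          ((supp u').card ≤ (supp u).card + 1 ∧
            objective X u' - objective X us ≤ ρ * (objective X u - objective X us) ∧
            ∀ ε, 0 < ε → ¬ ApproxOptimal X ε u →
              c * ε ^ 2 ≤ objective X u - objective X us)) := by
  have hn' : (1 : ℝ) ≤ n := by exact_mod_cast hn
  obtain ⟨K, d, hK, hd, hreg⟩ := exists_level_set_subset_region X hn H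
  obtain ⟨B, hnB, hB⟩ := exists_kappa_le X (K := K) hd
  obtain ⟨C, hC, hgap⟩ := exists_gap_le_sq X hn hus hK hd
  have hBpos : 0 < B := by linarith
  obtain ⟨c, hc⟩ : ∃ c : ℝ, c = 1 / (4 * B ^ 2) := ⟨_, rfl⟩
  have hcpos : 0 < c := hc ▸ by positivity
  have hC' : 0 < C + c := by positivity
  -- Using `C + c` instead of `C` keeps the rate strictly positive, so its logarithm can be taken.
  refine ⟨c, 1 - c / (C + c), hcpos, ?_, ?_, fun u u' hu hH ⟨j, hj, hu'⟩ => ?_⟩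
  · rw [sub_pos, div_lt_one hC']; linarith
  · linarith [div_pos hcpos hC']
  subst hu'
  have hmem := hreg u hu hH
  by_cases hdrop : IsDrop X u j
  · obtain ⟨h1, h2, h3⟩ := drop_step hn hu hj.1 hdrop
    refine ⟨h2, Or.inl ⟨?_, h3.le⟩⟩
    rw [newValue_of_isDrop hdrop]
    exact card_supp_update_zero h1.ne'
  · obtain ⟨h1, h2⟩ := full_step hn hu hdrop hnB (hB u hmem j)
    have h3 : (gradH X u j) ^ 2 / (4 * B ^ 2) = c * |gradH X u j| ^ 2 := by
      rw [hc, sq_abs]; ring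
    rw [h3] at h2
    refine ⟨h1, Or.inr ⟨card_supp_update_le _ _ _, ?_, fun ε hε hopt => ?_⟩⟩
    · have h4 := hgap u hmem _ (abs_nonneg (gradH X u j)) hj.2
      have h5 : c / (C + c) * (objective X u - objective X us) ≤ c * |gradH X u j| ^ 2 := by
        rw [div_mul_eq_mul_div, div_le_iff₀ hC', mul_assoc]
        refine mul_le_mul_of_nonneg_left ?_ hcpos.le
        nlinarith [sq_nonneg |gradH X u j|]
      linarith
    · obtain ⟨i, hi, hlt⟩ := lt_abs_gradH_of_not_approxOptimal hn hu hε hopt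
      have h4 : ε ≤ |gradH X u j| := hlt.le.trans (hj.2 i hi)
      have h5 : c * ε ^ 2 ≤ c * |gradH X u j| ^ 2 := by gcongr
      linarith [hmin _ h1]

/-- There are finitely many subsets `S`; hence one level set, and one set of constants, serves all
runs. -/
lemma exists_initial_objective_le : ∃ H : ℝ, ∀ u, IsInitial X u → objective X u ≤ H := by
  obtain ⟨H, hH⟩ := (Set.finite_range fun S : Finset (Fin m) =>
    objective X fun i => if i ∈ S then 1 / (S.card : ℝ) else 0).bddAbove
  refine ⟨H, fun u ⟨S, _, hu⟩ => ?_⟩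
  rw [funext hu]
  exact hH (Set.mem_range_self S)

/-- Linear convergence up to drop steps, of which there are at most `m` more than other steps. -/
lemma exists_linear_rate (hn : 0 < n) (hX : Submodule.span ℝ (Set.range X.col) = ⊤) :
    ∃ c ρ D : ℝ, 0 < c ∧ 0 < ρ ∧ ρ < 1 ∧ 0 < D ∧ ∀ u : ℕ → Fin m → ℝ, IsCDRun X u →
      ∀ ε : ℝ, 0 < ε → ∀ k : ℕ, (∀ i < k, ¬ ApproxOptimal X ε (u i)) →
        ∃ N : ℕ, k ≤ 2 * N + m ∧ ∀ M < N, c * ε ^ 2 ≤ ρ ^ M * D := by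
  have hinit : IsInitial X fun i : Fin m =>
      if i ∈ Finset.univ then 1 / ((Finset.univ : Finset (Fin m)).card : ℝ) else 0 :=
    ⟨Finset.univ, by simpa using hX, fun i => rfl⟩
  obtain ⟨us, hus, hmin⟩ := exists_minimizer X hn (feasible_of_isInitial X hn hinit).1
  obtain ⟨H, hH⟩ := exists_initial_objective_le X
  obtain ⟨c, ρ, hc, hρ, hρ1, hstep⟩ := exists_contraction X hn hus hmin H
  have hD : 0 ≤ H - objective X us :=
    sub_nonneg.2 ((hmin _ (feasible_of_isInitial X hn hinit).1).trans (hH _ hinit))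
  refine ⟨c, ρ, H - objective X us + 1, hc, hρ, hρ1, by linarith, fun u hu ε hε k hk => ?_⟩
  -- `N` counts the non-drop steps. A drop preserves `k + |supp|`; any other step raises it by at
  -- most two.
  suffices h : Feasible X (u k) ∧ objective X (u k) ≤ H ∧ ∃ N : ℕ,
      k + (supp (u k)).card ≤ 2 * N + m ∧
      objective X (u k) - objective X us ≤ ρ ^ N * (H - objective X us + 1) ∧
      ∀ M < N, c * ε ^ 2 ≤ ρ ^ M * (H - objective X us + 1) by
    obtain ⟨-, -, N, h1, -, h2⟩ := h
    exact ⟨N, by omega, h2⟩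
  induction k with
  | zero =>
    have h0 := hH _ hu.1
    refine ⟨(feasible_of_isInitial X hn hu.1).1, h0, 0, ?_, ?_, by simp⟩
    · simpa using card_supp_le (u 0)
    · rw [pow_zero]; linarith
  | succ k ih =>
    obtain ⟨hf, hle, N, hN, hgap, hall⟩ := ih fun i hi => hk i (by omega)
    obtain ⟨hf', ⟨h1, h2⟩ | ⟨h1, h2, h3⟩⟩ := hstep _ _ hf hle (hu.2 k)
    · exact ⟨hf', h2.trans hle, N, by omega, by linarith, hall⟩
    · have h4 := sub_nonneg.2 (hmin _ hf)
      refine ⟨hf', by nlinarith, N + 1, by omega, ?_, fun M hM => ?_⟩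
      · calc _ ≤ ρ * (objective X (u k) - objective X us) := h2
          _ ≤ ρ * (ρ ^ N * (H - objective X us + 1)) := by gcongr
          _ = _ := by ring
      · rcases Nat.lt_succ_iff_lt_or_eq.1 hM with h | rfl
        · exact hall M h
        · exact (h3 ε hε (hk k (by omega))).trans hgap

end Convergence

end MVEE

/-! ### The iteration bound -/

theorem theorem3 {n m : ℕ} (hn : 0 < n) (X : Matrix (Fin n) (Fin m) ℝ)
    (hX : Submodule.span ℝ (Set.range X.col) = ⊤) :
    ∃ P Q : ℝ, ∀ u : ℕ → Fin m → ℝ, MVEE.IsCDRun X u →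
      ∀ ε : ℝ, 0 < ε → ε ≤ 1 →
        ∃ k : ℕ, (k : ℝ) ≤ P + Q * Real.logb 2 (1 / ε) ∧ MVEE.ApproxOptimal X ε (u k) := by
  obtain ⟨c, ρ, D, hc, hρ, hρ1, hD, h⟩ := MVEE.exists_linear_rate X hn hX
  obtain ⟨l, hl⟩ : ∃ l, l = -Real.log ρ := ⟨_, rfl⟩
  have hl0 : 0 < l := by
    rw [hl, neg_pos]; exact Real.log_neg hρ hρ1
  have hlog2 : 0 < Real.log 2 := Real.log_pos one_lt_two
  -- From `c ε² ≤ ρ ^ (N - 1) D` follows `(N - 1) l ≤ |ln D - ln c| + 2 ln (1/ε)`; insert this in `2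
  -- N + m`. The absolute value ensures `T ≥ m + 2`, which excludes `N = 0`.
  refine ⟨m + 2 + 2 * |Real.log D - Real.log c| / l, 4 * Real.log 2 / l,
    fun u hu ε hε hε1 => ?_⟩
  obtain ⟨T, hT⟩ : ∃ T, T = (m : ℝ) + 2 + 2 * |Real.log D - Real.log c| / l +
    4 * Real.log 2 / l * Real.logb 2 (1 / ε) := ⟨_, rfl⟩
  have hL : 0 ≤ Real.logb 2 (1 / ε) :=
    Real.logb_nonneg one_lt_two ((one_le_div hε).2 hε1)
  have hT0 : (m : ℝ) + 2 ≤ T := by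
    have : 0 ≤ 2 * |Real.log D - Real.log c| / l := by positivity
    have : 0 ≤ 4 * Real.log 2 / l * Real.logb 2 (1 / ε) := by positivity
    linarith
  rw [← hT]
  by_contra! hcon
  have hT' : 0 ≤ T := by linarith [(Nat.cast_nonneg m : (0 : ℝ) ≤ m)]
  obtain ⟨N, hN, hall⟩ := h u hu ε hε (⌊T⌋₊ + 1) fun i hi =>
    hcon i ((Nat.le_floor_iff hT').1 (Nat.lt_succ_iff.1 hi))
  have hlt : T < 2 * N + m := (Nat.lt_floor_add_one T).trans_le (by exact_mod_cast hN)
  rcases N with _ | M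
  · simp only [Nat.cast_zero] at hlt
    linarith
  have h1 := Real.log_le_log (by positivity) (hall M (Nat.lt_succ_self M))
  rw [Real.log_mul hc.ne' (by positivity), Real.log_mul (by positivity) hD.ne', Real.log_pow,
    Real.log_pow] at h1
  have h2 : Real.logb 2 (1 / ε) * Real.log 2 = -Real.log ε := by
    rw [Real.logb, div_mul_cancel₀ _ hlog2.ne', one_div, Real.log_inv]
  have h3 : M * l ≤ |Real.log D - Real.log c| + 2 * (Real.logb 2 (1 / ε) * Real.log 2) := by
    rw [h2, hl]
    push_cast at h1
    linarith [le_abs_self (Real.log D - Real.log c)]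
  have h4 : T * l = (m + 2) * l + 2 * |Real.log D - Real.log c| +
      4 * (Real.logb 2 (1 / ε) * Real.log 2) := by
    rw [hT]; field_simp
  have h5 := mul_lt_mul_of_pos_right hlt hl0
  rw [h4] at h5
  push_cast at h5
  linarith
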